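/- **Setting.** Let $\mathcal V=(\mathcal V,\otimes,k)$ be a commutative unital quantale with $\bot\neq k$ and internal hom $\hom$, and let $\mathscr T=(\mathbb T,\mathcal V,\xi)$ be a (strict) topological theory with $T1=1$: $\mathbb T=(T,e,m)$ is a monad on $\mathbf{Set}$ such that $T$ preserves weak pullbacks and the naturality squares of $m$ are weak pullbacks; $\xi:T\mathcal V\to\mathcal V$ is a $\mathbb T$-algebra structure for which $\otimes:\mathcal V\times\mathcal V\to\mathcal V$ and $k:1\to\mathcal V$ are $\mathbb T$-homomorphisms; and the maps $\mathcal V^X\to\mathcal V^{TX}$, $\varphi\mapsto\xi\cdot T\varphi$, are monotone and natural with respect to $P_{\mathcal V}$, where $P_{\mathcal V}f(\varphi)(y)=\bigvee_{f(x)=y}\varphi(x)$. For $r:X\times Y\to\mathcal V$ put $T_\xi r(\mathfrak x,\mathfrak y)=\bigvee\{\xi(Tr(\mathfrak w))\mid \mathfrak w\in T(X\times Y),\,T\pi_1(\mathfrak w)=\mathfrak x,\,T\pi_2(\mathfrak w)=\mathfrak y\}$. Compose $\mathcal V$-relations by $(s\cdot r)(x,z)=\bigvee_y r(x,y)\otimes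 s(y,z)$, write $r^\circ(y,x)=r(x,y)$, and regard a map as the $\mathcal V$-relation with value $k$ on its graph and $\bot$ elsewhere. The Kleisli convolution of $\alpha:TX\times Y\to\mathcal V$ and $\beta:TY\times Z\to\mathcal V$ is $\beta\circ\alpha=\beta\cdot T_\xi\alpha\cdot m_X^\circ$. A $\mathscr T$-category is a set $X$ with $a:TX\times X\to\mathcal V$ such that $k\le a(e_X(x),x)$ and $T_\xi a(\mathfrak X,\mathfrak x)\otimes a(\mathfrak x,x)\le a(m_X(\mathfrak X),x)$. A $\mathscr T$-functor $f:(X,a)\to(Y,b)$ is a map with $a(\mathfrak x,x)\le b(Tf(\mathfrak x),f(x))$. These form the category $\mathbf{Cat}(\mathscr T)$. $\mathscr T$-functors $f,g:X\to Y$ are ordered by $f\le g$ iff $b(\mathfrak y,f(x))\le b(\mathfrak y,g(x))$ for all $\mathfrak y,x$; $f:X\to Y$ is left adjoint to $g:Y\to X$ if $1_X\le gf$ and $fg\le 1_Y$; and $X$ is separated if $f\le g\le f$ implies $f=g$ for all $\mathscr T$-functors $f,g$ into $X$. A $\mathscr T$-distributor $\varphi$ from $(X,a)$ to $(Y,b)$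 is a map $\varphi:TX\times Y\to\mathcal V$ with $\varphi\circ a\le\varphi$ and $b\circ\varphi\le\varphi$. Put $G=(1,e_1^\circ)$. *Limits.* A limit of a $\mathscr T$-functor $h:A\to X$ weighted by a $\mathscr T$-distributor $\varphi$ from $G$ to $A$ is an element $x_0\in X$ such that, writing $\varphi(z)$ for $\varphi(e_1(*),z)$, $$a(\mathfrak x,x_0)=\bigwedge_{z\in A}\hom(\varphi(z),a(\mathfrak x,h(z)))\qquad\text{for all }\mathfrak x\in TX .$$ $X$ is complete if all such weighted limits (for all $A$, $h$, $\varphi$) exist in $X$. A $\mathscr T$-functor $f:X\to Y$ is continuous if, whenever $x_0$ is a limit in $X$ of $h$ weighted by $\varphi$, $f(x_0)$ is a limit of $f\cdot h$ weighted by $\varphi$. *The monad $\mathbb V=(V,\mathsf y,\mathsf w)$ on $\mathbf{Cat}(\mathscr T)$.* $VX=(\mathcal V^X)^{\mathrm{op}}$: its elements are the maps $\varphi:X\to\mathcal V$ that are $\mathscr T$-functors $G\otimes X\to(\mathcal V,\hom(\xi(-),-))$, equivalently the $\mathscr T$-distributors from $G$ to $X$; its structure sends $(\mathfrak p,\varphi)$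 to $\bigwedge_{x}\hom(\varphi(x),\mu(\mathfrak p,x))$, where $\mu=a\cdot T_\xi\mathrm{ev}$ and $\mathrm{ev}(\varphi,x)=\varphi(x)$. For a $\mathscr T$-functor $f:(X,a)\to(Y,b)$, $Vf=f_\circledast\circ-$ with $f_\circledast(\mathfrak x,y)=b(Tf(\mathfrak x),y)$. The unit is $\mathsf y_X:X\to VX$, $x\mapsto a(e_X(x),-)$, and the multiplication is $\mathsf w_X=\mathsf y_X^\circledast\circ-:VVX\to VX$, where $\mathsf y_X^\circledast(\mathfrak p,x)$ is the value of the structure of $VX$ at $(\mathfrak p,\mathsf y_X(x))$. **Theorem.** 1. A $\mathscr T$-category $X$ is complete if and only if $\mathsf y_X:X\to VX$ has a right adjoint in $\mathbf{Cat}(\mathscr T)$. 2. The category $(\mathbf{Cat}(\mathscr T))^{\mathbb V}$ of Eilenberg–Moore algebras of $\mathbb V$ is precisely the category of complete and separated $\mathscr T$-categories and continuous $\mathscr T$-functors: the functor that forgets the algebra structure, $(X,\alpha)\mapsto X$, is an isomorphism of categories (bijective on objects and fully faithful) from $(\mathbf{Cat}(\mathscr T))^{\mathbb V}$ onto the category of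 complete separated $\mathscr T$-categories and continuous $\mathscr T$-functors, compatible with the forgetful functors to $\mathbf{Cat}(\mathscr T)$. -/

import Mathlib

open CategoryTheory Quantale

universe u

/-! ## Monads on sets and topological theories -/

section MonadOnSets

variable (T : CategoryTheory.Monad (Type u)) {X Y Z : Type u}

/-- The action `T f : T X → T Y` of a monad on sets on a map. -/
def tmap (f : X → Y) (t : T.obj X) : T.obj Y := T.map (↾f) t

/-- The unit `e_X : X → T X`. -/
def tunit (x : X) : T.obj X := T.η.app X x

/-- The multiplication `m_X : T T X → T X`. -/
def tmult (t : T.obj (T.obj X)) : T.obj X := T.μ.app X t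

theorem tmap_id (t : T.obj X) : tmap T (fun x => x) t = t := by
  have := T.map_id X
  exact types_congr_hom this t

theorem tmap_tmap (g : Y → Z) (f : X → Y) (t : T.obj X) :
    tmap T g (tmap T f t) = tmap T (fun x => g (f x)) t := by
  have := T.map_comp (↾f) (↾g)
  exact (types_congr_hom this t).symm

theorem tmap_tunit (f : X → Y) (x : X) : tmap T f (tunit T x) = tunit T (f x) := by
  have := T.η.naturality (↾f)
  exact (types_congr_hom this x).symm

theorem tmap_tmult (f : X → Y) (t : T.obj (T.obj X)) :
    tmap T f (tmult T t) = tmult T (tmap T (tmap T f) t) := by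
  have := T.μ.naturality (↾f)
  exact (types_congr_hom this t).symm

theorem tmult_tunit (t : T.obj X) : tmult T (tunit T t) = t :=
  types_congr_hom (T.left_unit X) t

theorem tmult_tmap_tunit (t : T.obj X) : tmult T (tmap T (tunit T) t) = t :=
  types_congr_hom (T.right_unit X) t

end MonadOnSets

/-- A weak pullback square of sets (`p`, `q` the projections, `f`, `g` the cospan). -/
def IsWeakPullback {P X Y Z : Type u} (p : P → X) (q : P → Y) (f : X → Z) (g : Y → Z) : Prop :=
  (∀ w, f (p w) = g (q w)) ∧ ∀ x y, f x = g y → ∃ w, p w = x ∧ q w = y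

/-- `P_V f : V^X → V^Y`, the left adjoint of the inverse image map `V^Y → V^X`. -/
def pushV {V : Type u} [CompleteLattice V] {X Y : Type u} (f : X → Y) (φ : X → V) : Y → V :=
  fun y => ⨆ (x : X) (_ : f x = y), φ x

/-- A (strict) topological theory `(T, V, ξ)` with underlying quantale `V`: the functor `T`
preserves weak pullbacks, the naturality squares of `m` are weak pullbacks, `(V, ξ)` is an
Eilenberg-Moore algebra, `⊗` and `k` are algebra homomorphisms, and the maps
`V^X → V^{TX}`, `φ ↦ ξ · T φ`, are monotone and natural, as morphisms from `P_V X` to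
`P_V (T X)`. -/
structure TopologicalTheory (V : Type u) [CommMonoid V] [CompleteLattice V] [IsQuantale V] where
  T : CategoryTheory.Monad (Type u)
  ξ : T.obj V → V
  map_weakPullback : ∀ {P X Y Z : Type u} (p : P → X) (q : P → Y) (f : X → Z) (g : Y → Z),
    IsWeakPullback p q f g → IsWeakPullback (tmap T p) (tmap T q) (tmap T f) (tmap T g)
  mult_weakPullback : ∀ {X Y : Type u} (f : X → Y),
    IsWeakPullback (tmult T) (tmap T (tmap T f)) (tmap T f) (tmult T)
  ξ_unit : ∀ v : V, ξ (tunit T v) = v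
  ξ_mult : ∀ v : T.obj (T.obj V), ξ (tmap T ξ v) = ξ (tmult T v)
  ξ_mul : ∀ w : T.obj (V × V),
    ξ (tmap T (fun p => p.1 * p.2) w) = ξ (tmap T Prod.fst w) * ξ (tmap T Prod.snd w)
  ξ_one : ∀ t : T.obj PUnit.{u + 1}, ξ (tmap T (fun _ => 1) t) = 1
  ξ_mono : ∀ {X : Type u} (φ ψ : X → V), φ ≤ ψ → ∀ t : T.obj X, ξ (tmap T φ t) ≤ ξ (tmap T ψ t)
  ξ_natural : ∀ {X Y : Type u} (f : X → Y) (φ : X → V) (t : T.obj Y),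
    ξ (tmap T (pushV f φ) t) = pushV (tmap T f) (fun s => ξ (tmap T φ s)) t

namespace TopologicalTheory

variable {V : Type u} [CommMonoid V] [CompleteLattice V] [IsQuantale V]
variable (𝒯 : TopologicalTheory V) {X Y Z W : Type u}

/-- The object part of the monad of the theory. -/
abbrev F (X : Type u) : Type u := 𝒯.T.obj X

/-- The map part of the monad of the theory. -/
abbrev map (f : X → Y) : 𝒯.F X → 𝒯.F Y := tmap 𝒯.T f

/-- The unit of the monad of the theory. -/
abbrev e (x : X) : 𝒯.F X := tunit 𝒯.T x

/-- The multiplication of the monad of the theory. -/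
abbrev m (t : 𝒯.F (𝒯.F X)) : 𝒯.F X := tmult 𝒯.T t

/-- `ξ_X : V^X → V^{TX}`, `φ ↦ ξ · T φ`. -/
def ξT (φ : X → V) (t : 𝒯.F X) : V := 𝒯.ξ (𝒯.map φ t)

/-- Composition `s · r` of `V`-relations. -/
def relComp (s : Y → Z → V) (r : X → Y → V) : X → Z → V :=
  fun x z => ⨆ y, r x y * s y z

/-- The opposite `r°` of a `V`-relation. -/
def relOp (r : X → Y → V) : Y → X → V := fun y x => r x y

/-- A map as a `V`-relation: value `k` on the graph and `⊥` elsewhere. -/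
def graph (f : X → Y) : X → Y → V := fun x y => ⨆ (_ : f x = y), (1 : V)

/-- The extension `T_ξ` of `T` to `V`-relations. -/
def ext (r : X → Y → V) : 𝒯.F X → 𝒯.F Y → V := fun x y =>
  ⨆ (w : 𝒯.F (X × Y)) (_ : 𝒯.map Prod.fst w = x ∧ 𝒯.map Prod.snd w = y),
    𝒯.ξT (fun p => r p.1 p.2) w

/-- Kleisli convolution `β ∘ α = β · T_ξ α · m°` of `𝒯`-relations. -/
def kleisli (β : 𝒯.F Y → Z → V) (α : 𝒯.F X → Y → V) : 𝒯.F X → Z → V :=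
  relComp β (relComp (𝒯.ext α) (relOp (graph 𝒯.m)))

/-! ### Elementary facts about `ξ` and `T_ξ` -/

theorem map_id (t : 𝒯.F X) : 𝒯.map (fun x => x) t = t := tmap_id _ t

theorem map_map (g : Y → Z) (f : X → Y) (t : 𝒯.F X) :
    𝒯.map g (𝒯.map f t) = 𝒯.map (fun x => g (f x)) t := tmap_tmap _ g f t

theorem map_e (f : X → Y) (x : X) : 𝒯.map f (𝒯.e x) = 𝒯.e (f x) := tmap_tunit _ f x

theorem map_m (f : X → Y) (t : 𝒯.F (𝒯.F X)) :
    𝒯.map f (𝒯.m t) = 𝒯.m (𝒯.map (𝒯.map f) t) := tmap_tmult _ f t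

theorem m_e (t : 𝒯.F X) : 𝒯.m (𝒯.e t) = t := tmult_tunit _ t

theorem m_map_e (t : 𝒯.F X) : 𝒯.m (𝒯.map (fun x => 𝒯.e x) t) = t := tmult_tmap_tunit _ t

theorem exists_of_isWeakPullback {P : Type u} {p : P → X} {q : P → Y} {f : X → Z} {g : Y → Z}
    (h : IsWeakPullback p q f g) {x : 𝒯.F X} {y : 𝒯.F Y} (hxy : 𝒯.map f x = 𝒯.map g y) :
    ∃ w, 𝒯.map p w = x ∧ 𝒯.map q w = y :=
  (𝒯.map_weakPullback p q f g h).2 x y hxy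

theorem iSup_mul_le {ι : Sort*} {f : ι → V} {u v : V} (h : ∀ i, f i * u ≤ v) :
    (⨆ i, f i) * u ≤ v := by
  rw [← leftMulResiduation_le_iff_mul_le]
  exact iSup_le fun i => leftMulResiduation_le_iff_mul_le.2 (h i)

theorem ξT_tunit (φ : X → V) (x : X) : 𝒯.ξT φ (𝒯.e x) = φ x := by
  unfold ξT; rw [map_e]; exact 𝒯.ξ_unit _

theorem ξT_map (f : X → Y) (φ : Y → V) (t : 𝒯.F X) :
    𝒯.ξT φ (𝒯.map f t) = 𝒯.ξT (fun x => φ (f x)) t := by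
  unfold ξT; rw [map_map]

theorem ξT_m (φ : X → V) (t : 𝒯.F (𝒯.F X)) : 𝒯.ξT φ (𝒯.m t) = 𝒯.ξT (𝒯.ξT φ) t := by
  unfold ξT
  rw [map_m]
  refine (𝒯.ξ_mult _).symm.trans ?_
  exact congrArg 𝒯.ξ (𝒯.map_map _ _ _)

theorem ξT_mono {φ ψ : X → V} (h : ∀ x, φ x ≤ ψ x) (t : 𝒯.F X) : 𝒯.ξT φ t ≤ 𝒯.ξT ψ t :=
  𝒯.ξ_mono φ ψ h t

theorem ξT_mul (φ ψ : X → V) (t : 𝒯.F X) :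
    𝒯.ξT (fun x => φ x * ψ x) t = 𝒯.ξT φ t * 𝒯.ξT ψ t := by
  have := 𝒯.ξ_mul (𝒯.map (fun x => (φ x, ψ x)) t)
  simp only [tmap_tmap] at this
  exact this

theorem ξT_one (t : 𝒯.F X) : 𝒯.ξT (fun _ => (1 : V)) t = 1 := by
  have := 𝒯.ξ_one (𝒯.map (fun _ => PUnit.unit) t)
  simp only [tmap_tmap] at this
  exact this

theorem ξT_pushV (f : X → Y) (φ : X → V) (t : 𝒯.F Y) :
    𝒯.ξT (pushV f φ) t = ⨆ (s : 𝒯.F X) (_ : 𝒯.map f s = t), 𝒯.ξT φ s :=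
  𝒯.ξ_natural f φ t

theorem ξT_iSup (g : Y → X → V) (t : 𝒯.F X) :
    𝒯.ξT (fun x => ⨆ y, g y x) t =
      ⨆ (w : 𝒯.F (Y × X)) (_ : 𝒯.map Prod.snd w = t), 𝒯.ξT (fun p => g p.1 p.2) w := by
  rw [← ξT_pushV]
  congr 1
  funext x
  apply le_antisymm
  · exact iSup_le fun y => le_iSup₂_of_le (y, x) rfl le_rfl
  · refine iSup₂_le ?_
    rintro ⟨y, x'⟩ rfl
    exact le_iSup (fun y => g y x') y

theorem le_ext (r : X → Y → V) (w : 𝒯.F (X × Y)) :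
    𝒯.ξT (fun p => r p.1 p.2) w ≤ 𝒯.ext r (𝒯.map Prod.fst w) (𝒯.map Prod.snd w) :=
  le_iSup₂_of_le w ⟨rfl, rfl⟩ le_rfl

theorem ext_le {r : X → Y → V} {x : 𝒯.F X} {y : 𝒯.F Y} {v : V}
    (h : ∀ w, 𝒯.map Prod.fst w = x → 𝒯.map Prod.snd w = y →
      𝒯.ξT (fun p => r p.1 p.2) w ≤ v) : 𝒯.ext r x y ≤ v :=
  iSup₂_le fun w hw => h w hw.1 hw.2

theorem ext_mul_le {r : X → Y → V} {x : 𝒯.F X} {y : 𝒯.F Y} {u v : V}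
    (h : ∀ w, 𝒯.map Prod.fst w = x → 𝒯.map Prod.snd w = y →
      𝒯.ξT (fun p => r p.1 p.2) w * u ≤ v) : 𝒯.ext r x y * u ≤ v := by
  rw [← leftMulResiduation_le_iff_mul_le]
  exact 𝒯.ext_le fun w h1 h2 => leftMulResiduation_le_iff_mul_le.2 (h w h1 h2)

theorem ext_mono {r s : X → Y → V} (h : ∀ x y, r x y ≤ s x y) (x : 𝒯.F X) (y : 𝒯.F Y) :
    𝒯.ext r x y ≤ 𝒯.ext s x y :=
  𝒯.ext_le fun w h1 h2 => by
    subst h1 h2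
    exact (𝒯.ξT_mono (fun p => h p.1 p.2) w).trans (𝒯.le_ext s w)

/-- `T_ξ (s · (f × g)) ≤ T_ξ s · (T f × T g)`. -/
theorem ext_comap_le (f : X → Z) (g : Y → W) (s : Z → W → V) (x : 𝒯.F X) (y : 𝒯.F Y) :
    𝒯.ext (fun x y => s (f x) (g y)) x y ≤ 𝒯.ext s (𝒯.map f x) (𝒯.map g y) := by
  refine 𝒯.ext_le fun w h1 h2 => ?_
  subst h1 h2
  have := 𝒯.le_ext s (𝒯.map (fun p : X × Y => (f p.1, g p.2)) w)
  rw [ξT_map] at this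
  simpa only [map_map] using this

theorem ext_comap_left (f : X → Z) (s : Z → Y → V) (x : 𝒯.F X) (y : 𝒯.F Y) :
    𝒯.ext (fun x y => s (f x) y) x y = 𝒯.ext s (𝒯.map f x) y := by
  apply le_antisymm
  · have := 𝒯.ext_comap_le f (fun y => y) s x y
    rwa [map_id] at this
  · refine 𝒯.ext_le fun w h1 h2 => ?_
    have hwp : IsWeakPullback (fun p : X × Y => (f p.1, p.2)) Prod.fst Prod.fst f :=
      ⟨fun _ => rfl, by rintro ⟨z, y⟩ x rfl; exact ⟨(x, y), rfl, rfl⟩⟩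
    obtain ⟨w', h3, h4⟩ := 𝒯.exists_of_isWeakPullback hwp h1
    have := 𝒯.le_ext (fun x y => s (f x) y) w'
    subst h3
    rw [map_map] at h2
    rw [ξT_map]
    rwa [h4, h2] at this

theorem le_ext_tunit (r : X → Y → V) (x : X) (y : Y) :
    r x y ≤ 𝒯.ext r (𝒯.e x) (𝒯.e y) := by
  have := 𝒯.le_ext r (𝒯.e (x, y))
  simpa only [ξT_tunit, map_e] using this

theorem one_le_ext {r : X → X → V} (h : ∀ x, 1 ≤ r x x) (x : 𝒯.F X) : 1 ≤ 𝒯.ext r x x := by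
  have := 𝒯.le_ext r (𝒯.map (fun x => (x, x)) x)
  rw [ξT_map, map_map, map_map, map_id] at this
  refine le_trans ?_ this
  rw [← 𝒯.ξT_one x]
  exact 𝒯.ξT_mono h x

/-- `T_ξ s · T_ξ r ≤ T_ξ (s · r)`. -/
theorem ext_mul_ext_le (s : Y → Z → V) (r : X → Y → V) (x : 𝒯.F X) (y : 𝒯.F Y) (z : 𝒯.F Z) :
    𝒯.ext r x y * 𝒯.ext s y z ≤ 𝒯.ext (relComp s r) x z := by
  refine 𝒯.ext_mul_le fun w h1 h2 => ?_
  rw [mul_comm]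
  refine 𝒯.ext_mul_le fun w' h3 h4 => ?_
  have hwp : IsWeakPullback (fun p : X × Y × Z => (p.1, p.2.1)) (fun p : X × Y × Z => p.2)
      Prod.snd Prod.fst :=
    ⟨fun _ => rfl, by rintro ⟨x, y⟩ ⟨y', z⟩ h; cases h; exact ⟨(x, y, z), rfl, rfl⟩⟩
  obtain ⟨q, rfl, rfl⟩ := 𝒯.exists_of_isWeakPullback hwp (h2.trans h3.symm)
  rw [ξT_map, ξT_map, ← ξT_mul]
  have := 𝒯.le_ext (relComp s r) (𝒯.map (fun p : X × Y × Z => (p.1, p.2.2)) q)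
  rw [map_map] at h1 h4
  rw [map_map, map_map, ξT_map, h1, h4] at this
  refine le_trans (𝒯.ξT_mono (fun p => ?_) q) this
  rw [mul_comm]
  exact le_iSup (fun y => r p.1 y * s y p.2.2) p.2.1

/-- `T_ξ (s · r) ≤ T_ξ s · T_ξ r`. -/
theorem ext_relComp_le (s : Y → Z → V) (r : X → Y → V) (x : 𝒯.F X) (z : 𝒯.F Z) :
    𝒯.ext (relComp s r) x z ≤ ⨆ y, 𝒯.ext r x y * 𝒯.ext s y z := by
  refine 𝒯.ext_le fun w h1 h2 => ?_
  unfold relComp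
  rw [𝒯.ξT_iSup (fun (y : Y) (p : X × Z) => r p.1 y * s y p.2)]
  refine iSup₂_le fun q hq => ?_
  subst hq
  rw [ξT_mul]
  refine le_iSup_of_le (𝒯.map Prod.fst q) (mul_le_mul' ?_ ?_)
  · have := 𝒯.le_ext r (𝒯.map (fun p : Y × X × Z => (p.2.1, p.1)) q)
    rw [map_map] at h1
    rwa [map_map, map_map, ξT_map, h1] at this
  · have := 𝒯.le_ext s (𝒯.map (fun p : Y × X × Z => (p.1, p.2.2)) q)
    rw [map_map] at h2
    rwa [map_map, map_map, ξT_map, h2] at this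

/-- `m_Y · T_ξ T_ξ r ≤ T_ξ r · m_X`. -/
theorem ext_ext_le (r : X → Y → V) (x : 𝒯.F (𝒯.F X)) (y : 𝒯.F (𝒯.F Y)) :
    𝒯.ext (𝒯.ext r) x y ≤ 𝒯.ext r (𝒯.m x) (𝒯.m y) := by
  refine 𝒯.ext_le fun w h1 h2 => ?_
  have key : (fun p : 𝒯.F X × 𝒯.F Y => 𝒯.ext r p.1 p.2) =
      pushV (fun q : 𝒯.F (X × Y) => (𝒯.map Prod.fst q, 𝒯.map Prod.snd q))
        (𝒯.ξT (fun p => r p.1 p.2)) := by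
    funext p
    unfold ext pushV
    simp only [Prod.ext_iff]
  rw [key, ξT_pushV]
  refine iSup₂_le fun q hq => ?_
  subst hq
  rw [map_map] at h1 h2
  subst h1 h2
  have := 𝒯.le_ext r (𝒯.m q)
  rwa [map_m, map_m, ξT_m] at this

theorem le_kleisli (β : 𝒯.F Y → Z → V) (α : 𝒯.F X → Y → V) (x : 𝒯.F (𝒯.F X)) (y : 𝒯.F Y)
    (z : Z) : 𝒯.ext α x y * β y z ≤ 𝒯.kleisli β α (𝒯.m x) z := by
  unfold kleisli relComp relOp graph
  refine le_iSup_of_le y (mul_le_mul' ?_ le_rfl)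
  refine le_iSup_of_le x ?_
  simp

theorem kleisli_le {β : 𝒯.F Y → Z → V} {α : 𝒯.F X → Y → V} {t : 𝒯.F X} {z : Z} {v : V}
    (h : ∀ x y, 𝒯.m x = t → 𝒯.ext α x y * β y z ≤ v) : 𝒯.kleisli β α t z ≤ v := by
  unfold kleisli relComp relOp graph
  refine iSup_le fun y => ?_
  refine iSup_mul_le fun x => ?_
  rw [mul_assoc]
  refine iSup_mul_le fun hx => ?_
  rw [one_mul]
  exact h x y hx

/-! ## `𝒯`-categories, `𝒯`-functors and `𝒯`-distributors -/

/-- A map compatible with two `𝒯`-graph structures. -/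
def IsFunctor (a : 𝒯.F X → X → V) (b : 𝒯.F Y → Y → V) (f : X → Y) : Prop :=
  ∀ t x, a t x ≤ b (𝒯.map f t) (f x)

end TopologicalTheory

open TopologicalTheory

variable {V : Type u} [CommMonoid V] [CompleteLattice V] [IsQuantale V]

/-- A `𝒯`-category `(X, a)`. -/
structure TCat (𝒯 : TopologicalTheory V) where
  carrier : Type u
  str : 𝒯.F carrier → carrier → V
  refl : ∀ x, 1 ≤ str (𝒯.e x) x
  trans : ∀ (s : 𝒯.F (𝒯.F carrier)) (t : 𝒯.F carrier) (x : carrier),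
    𝒯.ext str s t * str t x ≤ str (𝒯.m s) x

namespace TCat

variable {𝒯 : TopologicalTheory V}

/-- A `𝒯`-functor. -/
@[ext]
structure Hom (X Y : TCat 𝒯) where
  toFun : X.carrier → Y.carrier
  isFunctor : 𝒯.IsFunctor X.str Y.str toFun

instance : Category (TCat 𝒯) where
  Hom := Hom
  id X := ⟨fun x => x, fun t x => by rw [map_id]⟩
  comp f g := ⟨fun x => g.toFun (f.toFun x), fun t x => by
    rw [← map_map]
    exact (f.isFunctor t x).trans (g.isFunctor _ _)⟩

@[ext]
theorem hom_ext {X Y : TCat 𝒯} {f g : X ⟶ Y} (h : ∀ x, f.toFun x = g.toFun x) : f = g :=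
  Hom.ext (funext h)

/-- `f_⊛ = b · T f`. -/
def lowerStar {X : Type u} (Y : TCat 𝒯) (f : X → Y.carrier) : 𝒯.F X → Y.carrier → V :=
  fun t y => Y.str (𝒯.map f t) y

/-- `f^⊛ = f° · b`. -/
def upperStar {X : Type u} (Y : TCat 𝒯) (f : X → Y.carrier) : 𝒯.F Y.carrier → X → V :=
  fun t x => Y.str t (f x)

/-- The order on hom-sets: `f ≤ g` iff `f^⊛ ≤ g^⊛`. -/
instance {X Y : TCat 𝒯} : LE (X ⟶ Y) where
  le f g := ∀ t x, upperStar Y f.toFun t x ≤ upperStar Y g.toFun t x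

/-- `f` is left adjoint to `g` in the 2-category of `𝒯`-categories. -/
def IsAdjoint {X Y : TCat 𝒯} (f : X ⟶ Y) (g : Y ⟶ X) : Prop :=
  𝟙 X ≤ f ≫ g ∧ g ≫ f ≤ 𝟙 Y

/-- `X` is separated: equivalent `𝒯`-functors into `X` are equal. -/
def IsSeparated (X : TCat 𝒯) : Prop :=
  ∀ (Y : TCat 𝒯) (f g : Y ⟶ X), f ≤ g → g ≤ f → f = g

/-- The `𝒯`-category `G = (1, e_1°)`. -/
abbrev G (𝒯 : TopologicalTheory V) : TCat 𝒯 where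
  carrier := PUnit.{u + 1}
  str := relOp (graph (fun x => 𝒯.e x))
  refl x := by simp [relOp, graph]
  trans s t x := by
    refine 𝒯.ext_mul_le fun w h1 h2 => ?_
    have key : (fun p : 𝒯.F PUnit.{u + 1} × PUnit.{u + 1} =>
          relOp (graph (V := V) (fun x => 𝒯.e x)) p.1 p.2) =
        pushV (fun x : PUnit.{u + 1} => (𝒯.e x, x)) (fun _ => (1 : V)) := by
      funext p
      unfold relOp graph pushV
      apply le_antisymm
      · exact iSup_le fun h => le_iSup₂_of_le p.2 (Prod.ext h rfl) le_rfl
      · refine iSup₂_le fun q hq => ?_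
        exact le_iSup_of_le (by rw [← hq]) le_rfl
    rw [key, ξT_pushV]
    refine iSup_mul_le fun q => iSup_mul_le fun hq => ?_
    subst hq
    rw [map_map] at h1 h2
    subst h1 h2
    rw [ξT_one, one_mul, m_map_e, map_id]

/-- `φ : X ⇸ Y` is a `𝒯`-distributor. -/
def IsDistributor (X Y : TCat 𝒯) (φ : 𝒯.F X.carrier → Y.carrier → V) : Prop :=
  (∀ t y, 𝒯.kleisli φ X.str t y ≤ φ t y) ∧ (∀ t y, 𝒯.kleisli Y.str φ t y ≤ φ t y)

/-! ## Weighted limits -/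

/-- The lifting `φ ⊸ ψ` of `ψ : X ⇸ A` along `φ : G ⇸ A`. -/
def lifting {X A : Type u} (φ : 𝒯.F PUnit.{u + 1} → A → V) (ψ : 𝒯.F X → A → V) :
    𝒯.F X → PUnit.{u + 1} → V :=
  fun t p => ⨅ z, φ (𝒯.e p) z ⇨ₗ ψ t z

/-- `x` is a limit of the diagram given by `h : A ⟶ X` and the weight `φ : G ⇸ A`,
that is, `x^⊛ = φ ⊸ h^⊛`. -/
def IsLimit {A X : TCat 𝒯} (h : A ⟶ X) (φ : 𝒯.F PUnit.{u + 1} → A.carrier → V)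
    (x : X.carrier) : Prop :=
  upperStar X (fun _ : PUnit.{u + 1} => x) = lifting φ (upperStar X h.toFun)

/-- `X` is complete: all weighted limits with weights `G ⇸ A` exist in `X`. -/
def IsComplete (X : TCat 𝒯) : Prop :=
  ∀ (A : TCat 𝒯) (h : A ⟶ X) (φ : 𝒯.F PUnit.{u + 1} → A.carrier → V),
    IsDistributor (G 𝒯) A φ → ∃ x, IsLimit h φ x

/-- `f` is continuous: it preserves all weighted limits which exist in `X`. -/
def IsContinuous {X Y : TCat 𝒯} (f : X ⟶ Y) : Prop :=
  ∀ (A : TCat 𝒯) (h : A ⟶ X) (φ : 𝒯.F PUnit.{u + 1} → A.carrier → V),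
    IsDistributor (G 𝒯) A φ → ∀ x, IsLimit h φ x → IsLimit (h ≫ f) φ (f.toFun x)

end TCat

/-- Complete and separated `𝒯`-categories. -/
structure CompleteSepTCat (𝒯 : TopologicalTheory V) where
  toTCat : TCat 𝒯
  complete : toTCat.IsComplete
  separated : toTCat.IsSeparated

namespace CompleteSepTCat

variable {𝒯 : TopologicalTheory V}

/-- Continuous `𝒯`-functors. -/
@[ext]
structure Hom (X Y : CompleteSepTCat 𝒯) where
  hom : X.toTCat ⟶ Y.toTCat
  continuous : TCat.IsContinuous hom

/-- The category of complete separated `𝒯`-categories and continuous `𝒯`-functors. -/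
instance : Category (CompleteSepTCat 𝒯) where
  Hom := Hom
  id X := ⟨𝟙 _, fun _ _ _ _ _ hx => hx⟩
  comp f g := ⟨f.hom ≫ g.hom, fun A h φ hφ x hx =>
    g.continuous A (h ≫ f.hom) φ hφ _ (f.continuous A h φ hφ x hx)⟩

/-- The inclusion into the category of `𝒯`-categories. -/
def incl (𝒯 : TopologicalTheory V) : CompleteSepTCat 𝒯 ⥤ TCat 𝒯 where
  obj X := X.toTCat
  map f := f.hom

end CompleteSepTCat

namespace TCat

variable {𝒯 : TopologicalTheory V}

/-! ## The exponential `V^X` and its dual `V X` -/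

/-- The structure of the tensor product `X ⊗ Y`. -/
def tensorStr (X Y : TCat 𝒯) :
    𝒯.F (X.carrier × Y.carrier) → X.carrier × Y.carrier → V :=
  fun w p => X.str (𝒯.map Prod.fst w) p.1 * Y.str (𝒯.map Prod.snd w) p.2

/-- The structure `hom_ξ` of the `𝒯`-category `V`. -/
def homξ (𝒯 : TopologicalTheory V) : 𝒯.F V → V → V := fun t v => 𝒯.ξ t ⇨ₗ v

/-- The underlying set of the exponential `V^X`: maps `h : X → V` which are `𝒯`-functors of type
`G ⊗ X → V`. -/
@[ext]
structure VPow (X : TCat 𝒯) : Type u where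
  val : X.carrier → V
  isFunctor : 𝒯.IsFunctor (tensorStr (G 𝒯) X) (homξ 𝒯) (fun p => val p.2)

/-- The evaluation map as a `V`-relation from `V^X` to `X`. -/
def ev (X : TCat 𝒯) : X.VPow → X.carrier → V := fun h x => h.val x

/-- The `𝒯`-graph structure of the exponential `V^X`. -/
def expStr (X : TCat 𝒯) : 𝒯.F X.VPow → X.VPow → V := fun p h =>
  ⨅ (q : 𝒯.F (X.VPow × X.carrier)) (x : X.carrier) (_ : 𝒯.map Prod.fst q = p),
    X.str (𝒯.map Prod.snd q) x ⇨ₗ homξ 𝒯 (𝒯.map (fun r => ev X r.1 r.2) q) (h.val x)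

/-- The `V`-relation `μ = a · T_ξ ev`. -/
def mu (X : TCat 𝒯) : 𝒯.F X.VPow → X.carrier → V := relComp X.str (𝒯.ext X.ev)

/-- A map `φ : X → V`, regarded as the `𝒯`-relation `φ · e_1° : 1 ⇸ X`. -/
def ofPoint {X : Type u} (φ : X → V) : 𝒯.F PUnit.{u + 1} → X → V :=
  relComp (fun _ : PUnit.{u + 1} => φ) (relOp (graph (fun x => 𝒯.e x)))

/-- The action `ψ ∘ -` of a `𝒯`-relation `ψ : X ⇸ Y` on maps `X → V`, seen as `𝒯`-relations
from `1`. -/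
def postcomp {X Y : Type u} (ψ : 𝒯.F X → Y → V) (φ : X → V) : Y → V :=
  fun y => 𝒯.kleisli ψ (ofPoint φ) (𝒯.e PUnit.unit) y

theorem expStr_eq (X : TCat 𝒯) (p : 𝒯.F X.VPow) (h : X.VPow) :
    X.expStr p h = ⨅ x, X.mu p x ⇨ₗ h.val x := by
  unfold expStr homξ
  apply le_antisymm
  · refine le_iInf fun x => ?_
    rw [leftMulResiduation_le_iff_mul_le]
    unfold mu relComp
    rw [mul_iSup_distrib]
    refine iSup_le fun t => ?_
    rw [mul_left_comm]
    refine 𝒯.ext_mul_le fun q h1 h2 => ?_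
    subst h1 h2
    rw [mul_left_comm, mul_comm (𝒯.ξT _ _), ← mul_assoc]
    refine leftMulResiduation_le_iff_mul_le.1 (leftMulResiduation_le_iff_mul_le.1 ?_)
    exact (iInf_le _ q).trans ((iInf_le _ x).trans (iInf_le _ rfl))
  · refine le_iInf fun q => le_iInf fun x => le_iInf fun hq => ?_
    subst hq
    rw [leftMulResiduation_le_iff_mul_le, leftMulResiduation_le_iff_mul_le]
    have h3 := iInf_le (fun x => X.mu (𝒯.map Prod.fst q) x ⇨ₗ h.val x) x
    rw [leftMulResiduation_le_iff_mul_le] at h3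
    refine le_trans ?_ h3
    rw [mul_assoc]
    refine mul_le_mul' le_rfl ?_
    rw [mul_comm]
    exact le_iSup_of_le (f := fun y => 𝒯.ext X.ev (𝒯.map Prod.fst q) y * X.str y x)
      (𝒯.map Prod.snd q) (mul_le_mul' (𝒯.le_ext X.ev q) le_rfl)

theorem lowerStar_trans {X Y : TCat 𝒯} (f : X ⟶ Y) (s : 𝒯.F (𝒯.F X.carrier)) (y : 𝒯.F Y.carrier)
    (z : Y.carrier) :
    𝒯.ext (lowerStar Y f.toFun) s y * Y.str y z ≤ lowerStar Y f.toFun (𝒯.m s) z := by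
  unfold lowerStar
  rw [map_m]
  refine le_trans (mul_le_mul' ?_ le_rfl) (Y.trans _ _ _)
  rw [𝒯.ext_comap_left (𝒯.map f.toFun) Y.str]

/-! From here on `T1 = 1`. -/

variable [Subsingleton (𝒯.F PUnit.{u + 1})]

theorem ξT_const {X : Type u} (v : V) (t : 𝒯.F X) : 𝒯.ξT (fun _ => v) t = v := by
  have h : 𝒯.map (fun _ => PUnit.unit.{u + 1}) t = 𝒯.e PUnit.unit := Subsingleton.elim _ _
  have h2 := 𝒯.ξT_map (fun _ : X => PUnit.unit.{u + 1}) (fun _ => v) t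
  rw [← h2, h, ξT_tunit]

theorem str_G (t : 𝒯.F (G 𝒯).carrier) (x : (G 𝒯).carrier) : (G 𝒯).str t x = 1 := by
  have h : 𝒯.e x = t := Subsingleton.elim (α := 𝒯.F PUnit.{u + 1}) _ _
  exact le_antisymm (iSup_le fun _ => le_rfl) (le_iSup_of_le h le_rfl)

/-- Elementwise description of the elements of `V^X`. -/
theorem isFunctor_iff (X : TCat 𝒯) (h : X.carrier → V) :
    𝒯.IsFunctor (tensorStr (G 𝒯) X) (homξ 𝒯) (fun p => h p.2) ↔
      ∀ t x, 𝒯.ξT h t * X.str t x ≤ h x := by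
  constructor
  · intro H t x
    have := H (𝒯.map (fun x => ((PUnit.unit : (G 𝒯).carrier), x)) t) ((PUnit.unit : (G 𝒯).carrier), x)
    unfold tensorStr homξ at this
    rw [str_G, one_mul, leftMulResiduation_le_iff_mul_le, map_map, map_map, map_id] at this
    rw [mul_comm]
    exact this
  · intro H w p
    have := H (𝒯.map Prod.snd w) p.2
    unfold tensorStr homξ
    rw [str_G, one_mul, leftMulResiduation_le_iff_mul_le, mul_comm]
    rwa [ξT_map] at this

theorem VPow.le {X : TCat 𝒯} (h : X.VPow) (t : 𝒯.F X.carrier) (x : X.carrier) :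
    𝒯.ξT h.val t * X.str t x ≤ h.val x :=
  (isFunctor_iff X h.val).1 h.2 t x

theorem VPow.le_tunit {X : TCat 𝒯} (h : X.VPow) (y x : X.carrier) :
    h.val y * X.str (𝒯.e y) x ≤ h.val x := by
  have := h.le (𝒯.e y) x
  rwa [ξT_tunit] at this

/-- `T_ξ r (e x, -) = ξ · T (r (x, -))`. -/
theorem ext_tunit {X Y : Type u} (r : X → Y → V) (x : X) (t : 𝒯.F Y) :
    𝒯.ext r (𝒯.e x) t = 𝒯.ξT (r x) t := by
  have h1 := 𝒯.ext_comap_left (fun _ : PUnit.{u + 1} => x) r (𝒯.e PUnit.unit) t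
  rw [map_e] at h1
  rw [← h1]
  apply le_antisymm
  · refine 𝒯.ext_le fun w h2 h3 => ?_
    rw [← h3, ξT_map]
  · have := 𝒯.le_ext (fun (_ : PUnit.{u + 1}) y => r x y)
      (𝒯.map (fun y => (PUnit.unit, y)) t)
    rw [ξT_map, map_map, map_map, map_id] at this
    refine this.trans (le_of_eq ?_)
    congr 1
    exact Subsingleton.elim _ _

theorem mu_tunit (X : TCat 𝒯) (h : X.VPow) (x : X.carrier) : X.mu (𝒯.e h) x = h.val x := by
  unfold mu relComp
  apply le_antisymm
  · refine iSup_le fun t => ?_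
    rw [ext_tunit]
    exact h.le t x
  · refine le_iSup_of_le (𝒯.e x) ?_
    rw [ext_tunit, ξT_tunit]
    exact le_mul_of_one_le_right' (X.refl x)

/-- For every `p` in `T (V^X)`, the map `μ (p, -)` belongs to `V^X`. -/
theorem isFunctor_mu (X : TCat 𝒯) (p : 𝒯.F X.VPow) :
    𝒯.IsFunctor (tensorStr (G 𝒯) X) (homξ 𝒯) (fun q => X.mu p q.2) := by
  rw [isFunctor_iff]
  intro t x
  rw [show 𝒯.ξT (fun q => X.mu p q) t = 𝒯.ext X.mu (𝒯.e p) t from (ext_tunit X.mu p t).symm]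
  refine le_trans (mul_le_mul' (𝒯.ext_relComp_le _ _ _ _) le_rfl) ?_
  rw [iSup_mul_distrib]
  refine iSup_le fun s => ?_
  rw [mul_assoc]
  refine le_trans (mul_le_mul' (𝒯.ext_ext_le _ _ _) (X.trans s t x)) ?_
  rw [m_e]
  exact le_iSup (fun y => 𝒯.ext X.ev p y * X.str y x) (𝒯.m s)

/-- The map `T (V^X) → V^X` induced by `μ`. -/
def muMap (X : TCat 𝒯) (p : 𝒯.F X.VPow) : X.VPow := ⟨X.mu p, X.isFunctor_mu p⟩

/-- The `𝒯`-graph `V^X` is dualisable: its structure is `d = d_0 · μ`. -/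
theorem expStr_dualisable (X : TCat 𝒯) (p : 𝒯.F X.VPow) (h : X.VPow) :
    X.expStr p h = X.expStr (𝒯.e (X.muMap p)) h := by
  simp only [expStr_eq, mu_tunit]
  rfl

/-- The structure `d_0° · μ` of the dual `(V^X)^op` of the exponential `V^X = (V^X, d_0 · μ)`. -/
def VStr (X : TCat 𝒯) : 𝒯.F X.VPow → X.VPow → V :=
  fun p h => X.expStr (𝒯.e h) (X.muMap p)

theorem le_VStr_iff {X : TCat 𝒯} {p : 𝒯.F X.VPow} {h : X.VPow} {v : V} :
    v ≤ X.VStr p h ↔ ∀ x, v * h.val x ≤ X.mu p x := by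
  unfold VStr
  rw [expStr_eq]
  simp only [mu_tunit, le_iInf_iff, leftMulResiduation_le_iff_mul_le]
  rfl

theorem VStr_mul_le (X : TCat 𝒯) (p : 𝒯.F X.VPow) (h : X.VPow) (x : X.carrier) :
    X.VStr p h * h.val x ≤ X.mu p x :=
  le_VStr_iff.1 le_rfl x

/-- The `𝒯`-category `V X = (V^X)^op`. -/
abbrev Vobj (X : TCat 𝒯) : TCat 𝒯 where
  carrier := X.VPow
  str := X.VStr
  refl h := by
    rw [le_VStr_iff]
    intro x
    rw [mu_tunit, one_mul]
  trans s t h := by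
    rw [le_VStr_iff]
    intro x
    rw [mul_assoc]
    refine le_trans (mul_le_mul' le_rfl (X.VStr_mul_le t h x)) ?_
    unfold mu relComp
    rw [mul_iSup_distrib]
    refine iSup_le fun y => ?_
    rw [← mul_assoc]
    have h1 : 𝒯.ext X.VStr s t * 𝒯.ext X.ev t y ≤ 𝒯.ext X.mu s y := by
      refine (𝒯.ext_mul_ext_le _ _ _ _ _).trans (𝒯.ext_mono (fun p x => ?_) _ _)
      exact iSup_le fun h => X.VStr_mul_le p h x
    refine le_trans (mul_le_mul' h1 le_rfl) ?_
    refine le_trans (mul_le_mul' (𝒯.ext_relComp_le _ _ _ _) le_rfl) ?_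
    rw [iSup_mul_distrib]
    refine iSup_le fun z => ?_
    rw [mul_assoc]
    refine le_trans (mul_le_mul' (𝒯.ext_ext_le _ _ _) (X.trans _ _ _)) ?_
    exact le_iSup (fun y => 𝒯.ext X.ev (𝒯.m s) y * X.str y x) (𝒯.m z)

/-! ## The monad `V` -/

theorem postcomp_apply {X Y : Type u} (ψ : 𝒯.F X → Y → V) (φ : X → V) (y : Y) :
    postcomp ψ φ y = ⨆ t, 𝒯.ξT φ t * ψ t y := by
  have h1 : ∀ (s : 𝒯.F PUnit.{u + 1}), ofPoint (𝒯 := 𝒯) φ s = φ := by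
    intro s
    funext x
    unfold ofPoint relComp relOp graph
    apply le_antisymm
    · exact iSup_le fun p => iSup_mul_le fun _ => (one_mul _).le
    · refine le_iSup_of_le PUnit.unit ?_
      have h : 𝒯.e PUnit.unit.{u + 1} = s := Subsingleton.elim _ _
      simp [h]
  have h2 : ∀ (s : 𝒯.F (𝒯.F PUnit.{u + 1})) (t : 𝒯.F X),
      𝒯.ext (ofPoint (𝒯 := 𝒯) φ) s t ≤ 𝒯.ξT φ t := by
    intro s t
    refine 𝒯.ext_le fun w h2 h3 => ?_
    simp only [h1]
    rw [← h3, ξT_map]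
  have h3 : ∀ (t : 𝒯.F X),
      𝒯.ξT φ t ≤ 𝒯.ext (ofPoint (𝒯 := 𝒯) φ) (𝒯.e (𝒯.e PUnit.unit)) t := by
    intro t
    rw [ext_tunit, h1]
  unfold postcomp
  apply le_antisymm
  · refine 𝒯.kleisli_le fun s t _ => ?_
    exact le_iSup_of_le t (mul_le_mul' (h2 s t) le_rfl)
  · refine iSup_le fun t => ?_
    have := 𝒯.le_kleisli ψ (ofPoint φ) (𝒯.e (𝒯.e PUnit.unit)) t y
    rw [m_e] at this
    exact (mul_le_mul' (h3 t) le_rfl).trans this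

theorem le_postcomp {X Y : Type u} (ψ : 𝒯.F X → Y → V) (φ : X → V) (t : 𝒯.F X) (y : Y) :
    𝒯.ξT φ t * ψ t y ≤ postcomp ψ φ y := by
  rw [postcomp_apply]
  exact le_iSup (fun t => 𝒯.ξT φ t * ψ t y) t

theorem postcomp_le {X Y : Type u} {ψ : 𝒯.F X → Y → V} {φ : X → V} {y : Y} {v : V}
    (h : ∀ t, 𝒯.ξT φ t * ψ t y ≤ v) : postcomp ψ φ y ≤ v := by
  rw [postcomp_apply]
  exact iSup_le h

theorem postcomp_mono {X Y : Type u} (ψ : 𝒯.F X → Y → V) {φ φ' : X → V}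
    (h : ∀ x, φ x ≤ φ' x) (y : Y) : postcomp ψ φ y ≤ postcomp ψ φ' y :=
  postcomp_le fun t => (mul_le_mul' (𝒯.ξT_mono h t) le_rfl).trans (le_postcomp ψ φ' t y)

theorem mul_postcomp_le {X Y : Type u} (ψ : 𝒯.F X → Y → V) {φ φ' : X → V} {v : V}
    (h : ∀ x, v * φ x ≤ φ' x) (y : Y) : v * postcomp ψ φ y ≤ postcomp ψ φ' y := by
  rw [mul_comm, postcomp_apply]
  refine iSup_mul_le fun t => ?_
  rw [mul_right_comm, mul_comm (𝒯.ξT φ t)]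
  refine le_trans (mul_le_mul' ?_ le_rfl) (le_postcomp ψ φ' t y)
  have h1 : v * 𝒯.ξT φ t = 𝒯.ξT (fun x => v * φ x) t := by
    rw [𝒯.ξT_mul (fun _ => v) φ, ξT_const]
  rw [h1]
  exact 𝒯.ξT_mono h t

theorem ξT_postcomp_le {X Y : Type u} (ψ : 𝒯.F X → Y → V) (φ : X → V) (y : 𝒯.F Y) :
    𝒯.ξT (postcomp ψ φ) y ≤ ⨆ s, 𝒯.ξT φ (𝒯.m s) * 𝒯.ext ψ s y := by
  have h : postcomp ψ φ = fun y => ⨆ t, 𝒯.ξT φ t * ψ t y := funext (postcomp_apply ψ φ)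
  rw [h, 𝒯.ξT_iSup (fun t y => 𝒯.ξT φ t * ψ t y)]
  refine iSup₂_le fun w hw => ?_
  subst hw
  rw [ξT_mul]
  refine le_iSup_of_le (𝒯.map Prod.fst w) (mul_le_mul' ?_ (𝒯.le_ext ψ w))
  rw [ξT_m, ξT_map]

/-- `Vf = f_⊛ ∘ -`. -/
def Vmap {X Y : TCat 𝒯} (f : X ⟶ Y) (h : X.VPow) : Y.VPow where
  val := postcomp (lowerStar Y f.toFun) h.val
  isFunctor := by
    rw [isFunctor_iff]
    intro t y
    refine le_trans (mul_le_mul' (ξT_postcomp_le _ _ _) le_rfl) ?_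
    refine iSup_mul_le fun s => ?_
    rw [mul_assoc]
    exact (mul_le_mul' le_rfl (lowerStar_trans f s t y)).trans (le_postcomp _ _ (𝒯.m s) y)

theorem le_Vmap {X Y : TCat 𝒯} (f : X ⟶ Y) (h : X.VPow) (x : X.carrier) :
    h.val x ≤ (Vmap f h).val (f.toFun x) := by
  refine le_trans ?_ (le_postcomp _ _ (𝒯.e x) _)
  unfold lowerStar
  rw [ξT_tunit, map_e]
  exact le_mul_of_one_le_right' (Y.refl _)

theorem Vmap_muMap_le {X Y : TCat 𝒯} (f : X ⟶ Y) (p : 𝒯.F X.VPow) (y : Y.carrier) :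
    (Vmap f (X.muMap p)).val y ≤ Y.mu (𝒯.map (Vmap f) p) y := by
  refine postcomp_le fun t => ?_
  rw [show 𝒯.ξT (X.muMap p).val t = 𝒯.ext X.mu (𝒯.e p) t from (ext_tunit X.mu p t).symm]
  refine le_trans (mul_le_mul' (𝒯.ext_relComp_le _ _ _ _) le_rfl) ?_
  refine iSup_mul_le fun s => ?_
  rw [mul_assoc]
  have h1 : 𝒯.ext X.str s t * lowerStar Y f.toFun t y ≤
      Y.str (𝒯.map f.toFun (𝒯.m s)) y := by
    rw [map_m]
    refine le_trans (mul_le_mul' ?_ le_rfl) (Y.trans _ (𝒯.map f.toFun t) _)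
    refine (𝒯.ext_mono (fun t x => f.isFunctor t x) s t).trans ?_
    exact 𝒯.ext_comap_le (𝒯.map f.toFun) f.toFun Y.str s t
  have h2 : 𝒯.ext (𝒯.ext X.ev) (𝒯.e p) s ≤
      𝒯.ext Y.ev (𝒯.map (Vmap f) p) (𝒯.map f.toFun (𝒯.m s)) := by
    refine (𝒯.ext_ext_le _ _ _).trans ?_
    rw [m_e]
    refine (𝒯.ext_mono (fun h x => le_Vmap f h x) _ _).trans ?_
    exact 𝒯.ext_comap_le (Vmap f) f.toFun Y.ev _ _
  exact (mul_le_mul' h2 h1).trans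
    (le_iSup (fun t => 𝒯.ext Y.ev (𝒯.map (Vmap f) p) t * Y.str t y) _)

/-- The `𝒯`-functor `Vf : V X ⟶ V Y`. -/
def VmapHom {X Y : TCat 𝒯} (f : X ⟶ Y) : X.Vobj ⟶ Y.Vobj :=
  Hom.mk (Vmap f) fun p h => le_VStr_iff.2 fun y =>
    (mul_postcomp_le _ (X.VStr_mul_le p h) y).trans (Vmap_muMap_le f p y)

/-- The Yoneda map `x ↦ a_0 (x, -)`. -/
def yo (X : TCat 𝒯) (x : X.carrier) : X.VPow where
  val y := X.str (𝒯.e x) y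
  isFunctor := by
    rw [isFunctor_iff]
    intro t y
    rw [show 𝒯.ξT (fun y => X.str (𝒯.e x) y) t = 𝒯.ext X.str (𝒯.e (𝒯.e x)) t from
      (ext_tunit X.str (𝒯.e x) t).symm]
    have := X.trans (𝒯.e (𝒯.e x)) t y
    rwa [m_e] at this

/-- The Yoneda lemma: `⟪p, yo x⟫ = μ (p, x)`. -/
theorem VStr_yo (X : TCat 𝒯) (p : 𝒯.F X.VPow) (x : X.carrier) : X.VStr p (X.yo x) = X.mu p x := by
  apply le_antisymm
  · exact (le_mul_of_one_le_right' (X.refl x)).trans (X.VStr_mul_le p (X.yo x) x)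
  · exact le_VStr_iff.2 fun y => (X.muMap p).le_tunit x y

theorem mu_map_yo (X : TCat 𝒯) (t : 𝒯.F X.carrier) (x : X.carrier) :
    X.mu (𝒯.map X.yo t) x = X.str t x := by
  have h : ∀ s, 𝒯.ext X.ev (𝒯.map X.yo t) s = 𝒯.ext (fun x y => X.str (𝒯.e x) y) t s :=
    fun s => (𝒯.ext_comap_left X.yo X.ev t s).symm
  unfold mu relComp
  simp only [h]
  apply le_antisymm
  · refine iSup_le fun s => ?_
    rw [𝒯.ext_comap_left (fun x => 𝒯.e x) X.str]
    have := X.trans (𝒯.map (fun x => 𝒯.e x) t) s x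
    rwa [m_map_e] at this
  · refine le_iSup_of_le t (le_mul_of_one_le_left' ?_)
    exact 𝒯.one_le_ext X.refl t

/-- The Yoneda functor `X ⟶ V X`. -/
def coyoneda (X : TCat 𝒯) : X ⟶ X.Vobj :=
  Hom.mk X.yo fun t x => by
    change _ ≤ X.VStr _ _
    rw [VStr_yo, mu_map_yo]

/-- The multiplication `V V X → V X`, that is, `yo^⊛ ∘ -`. -/
def Vmult (X : TCat 𝒯) (Φ : X.Vobj.VPow) : X.VPow where
  val := postcomp (upperStar X.Vobj X.yo) Φ.val
  isFunctor := by
    have h : postcomp (upperStar X.Vobj X.yo) Φ.val = fun x => Φ.val (X.yo x) := by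
      funext x
      apply le_antisymm
      · exact postcomp_le fun t => Φ.le t _
      · refine le_trans ?_ (le_postcomp _ _ (𝒯.e (X.yo x)) x)
        rw [ξT_tunit]
        exact le_mul_of_one_le_right' (X.Vobj.refl _)
    rw [h]
    refine (isFunctor_iff X (fun x => Φ.val (X.yo x))).2 fun t x => ?_
    refine le_trans ?_ (Φ.le (𝒯.map X.yo t) (X.yo x))
    rw [ξT_map]
    exact mul_le_mul' le_rfl (X.coyoneda.isFunctor t x)

theorem Vmult_val (X : TCat 𝒯) (Φ : X.Vobj.VPow) (x : X.carrier) :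
    (X.Vmult Φ).val x = Φ.val (X.yo x) := by
  apply le_antisymm
  · exact postcomp_le fun t => Φ.le t _
  · refine le_trans ?_ (le_postcomp _ _ (𝒯.e (X.yo x)) x)
    rw [ξT_tunit]
    exact le_mul_of_one_le_right' (X.Vobj.refl _)

/-- `Φ (h) ⊗ h (x) ≤ Φ (yo x)`. -/
theorem VPow_mul_le (X : TCat 𝒯) (Φ : X.Vobj.VPow) (h : X.VPow) (x : X.carrier) :
    Φ.val h * h.val x ≤ Φ.val (X.yo x) := by
  have h1 := Φ.le_tunit h (X.yo x)
  rwa [show X.Vobj.str (𝒯.e h) (X.yo x) = h.val x from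
    (X.VStr_yo (𝒯.e h) x).trans (X.mu_tunit h x)] at h1

/-- The multiplication as a `𝒯`-functor `V V X ⟶ V X`. -/
def VmultHom (X : TCat 𝒯) : X.Vobj.Vobj ⟶ X.Vobj :=
  Hom.mk X.Vmult fun P Φ => by
    refine le_VStr_iff.2 fun x => ?_
    rw [Vmult_val]
    refine (X.Vobj.VStr_mul_le P Φ (X.yo x)).trans ?_
    refine iSup_le fun p => ?_
    rw [show X.Vobj.str p (X.yo x) = X.mu p x from X.VStr_yo p x]
    unfold mu relComp
    rw [mul_iSup_distrib]
    refine iSup_le fun t => ?_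
    rw [← mul_assoc]
    refine le_trans (mul_le_mul' ?_ le_rfl)
      (le_iSup (fun t => 𝒯.ext X.ev (𝒯.map X.Vmult P) t * X.str t x) t)
    refine (𝒯.ext_mul_ext_le _ _ _ _ _).trans ?_
    rw [← 𝒯.ext_comap_left X.Vmult X.ev]
    refine 𝒯.ext_mono (fun Φ x => ?_) _ _
    refine iSup_le fun h => ?_
    exact (X.VPow_mul_le Φ h x).trans (X.Vmult_val Φ x).ge

theorem Vmap_id (X : TCat 𝒯) (h : X.VPow) : Vmap (𝟙 X) h = h := by
  ext x
  apply le_antisymm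
  · refine postcomp_le fun t => ?_
    have := h.le t x
    have h1 : lowerStar X (𝟙 X : X ⟶ X).toFun t x = X.str t x :=
      congrArg (fun s => X.str s x) (𝒯.map_id t)
    rwa [← h1] at this
  · exact le_Vmap (𝟙 X) h x

theorem Vmap_comp {X Y Z : TCat 𝒯} (f : X ⟶ Y) (g : Y ⟶ Z) (h : X.VPow) :
    Vmap (f ≫ g) h = Vmap g (Vmap f h) := by
  ext z
  apply le_antisymm
  · refine postcomp_le fun t => ?_
    have h1 : 𝒯.ξT h.val t ≤ 𝒯.ξT (Vmap f h).val (𝒯.map f.toFun t) := by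
      rw [ξT_map]
      exact 𝒯.ξT_mono (le_Vmap f h) t
    refine (mul_le_mul' h1 ?_).trans (le_postcomp (lowerStar Z g.toFun) _ (𝒯.map f.toFun t) z)
    unfold lowerStar
    rw [map_map]
    exact le_rfl
  · refine postcomp_le fun t => ?_
    refine (mul_le_mul' (ξT_postcomp_le _ _ _) le_rfl).trans ?_
    refine iSup_mul_le fun s => ?_
    rw [mul_assoc]
    refine le_trans (mul_le_mul' le_rfl ?_) (le_postcomp _ _ (𝒯.m s) z)
    unfold lowerStar
    rw [map_m]
    refine le_trans (mul_le_mul' ?_ le_rfl) (Z.trans _ (𝒯.map g.toFun t) z)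
    rw [𝒯.ext_comap_left (𝒯.map f.toFun) Y.str]
    refine (𝒯.ext_mono (fun t x => g.isFunctor t x) _ t).trans ?_
    refine (𝒯.ext_comap_le (𝒯.map g.toFun) g.toFun Z.str _ t).trans ?_
    rw [map_map]
    refine le_of_eq ?_
    congr 2
    funext t
    exact 𝒯.map_map _ _ _

theorem Vmap_mono {X Y : TCat 𝒯} (f : X ⟶ Y) {h h' : X.VPow} (H : ∀ x, h.val x ≤ h'.val x)
    (y : Y.carrier) : (Vmap f h).val y ≤ (Vmap f h').val y :=
  postcomp_mono _ H y

theorem Vmap_yo {X Y : TCat 𝒯} (f : X ⟶ Y) (x : X.carrier) :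
    Vmap f (X.yo x) = Y.yo (f.toFun x) := by
  ext y
  apply le_antisymm
  · refine postcomp_le fun t => ?_
    have h1 : 𝒯.ξT (X.yo x).val t ≤ 𝒯.ξT (Y.yo (f.toFun x)).val (𝒯.map f.toFun t) := by
      rw [ξT_map]
      refine 𝒯.ξT_mono (fun z => ?_) t
      have := f.isFunctor (𝒯.e x) z
      rwa [map_e] at this
    exact (mul_le_mul' h1 le_rfl).trans ((Y.yo (f.toFun x)).le _ y)
  · refine le_trans ?_ (le_postcomp _ _ (𝒯.e x) y)
    rw [ξT_tunit]
    unfold lowerStar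
    rw [map_e]
    exact le_mul_of_one_le_left' (X.refl x)

/-- `w · yo_{VX} = 1`. -/
theorem Vmult_yo (X : TCat 𝒯) (h : X.VPow) : X.Vmult (X.Vobj.yo h) = h := by
  ext x
  rw [Vmult_val]
  exact (X.VStr_yo (𝒯.e h) x).trans (X.mu_tunit h x)

/-- `w · V yo_X = 1`. -/
theorem Vmult_Vmap_yo (X : TCat 𝒯) (h : X.VPow) : X.Vmult (Vmap X.coyoneda h) = h := by
  ext x
  rw [Vmult_val]
  have h1 : ∀ t, lowerStar X.Vobj X.coyoneda.toFun t (X.yo x) = X.str t x :=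
    fun t => (X.VStr_yo _ x).trans (X.mu_map_yo t x)
  apply le_antisymm
  · refine postcomp_le fun t => ?_
    rw [h1]
    exact h.le t x
  · refine le_trans ?_ (le_postcomp _ _ (𝒯.e x) _)
    rw [ξT_tunit, h1]
    exact le_mul_of_one_le_right' (X.refl x)

theorem le_yo_Vmult (X : TCat 𝒯) (Φ : X.Vobj.VPow) (h : X.VPow) :
    Φ.val h ≤ (X.Vobj.yo (X.Vmult Φ)).val h := by
  refine le_VStr_iff.2 fun x => ?_
  rw [mu_tunit, Vmult_val]
  exact X.VPow_mul_le Φ h x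

theorem Vmap_yo_Vmult_le (X : TCat 𝒯) (Φ : X.Vobj.VPow) (h : X.VPow) :
    (Vmap X.coyoneda (X.Vmult Φ)).val h ≤ Φ.val h := by
  refine postcomp_le fun t => ?_
  refine le_trans (mul_le_mul' ?_ le_rfl) (Φ.le (𝒯.map X.yo t) h)
  rw [ξT_map]
  exact 𝒯.ξT_mono (fun x => (X.Vmult_val Φ x).le) t

theorem Vmult_mono (X : TCat 𝒯) {Φ Φ' : X.Vobj.VPow} (H : ∀ h, Φ.val h ≤ Φ'.val h)
    (x : X.carrier) : (X.Vmult Φ).val x ≤ (X.Vmult Φ').val x :=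
  postcomp_mono _ H x

theorem Vmult_natural {X Y : TCat 𝒯} (f : X ⟶ Y) (Φ : X.Vobj.VPow) :
    Y.Vmult (Vmap (VmapHom f) Φ) = Vmap f (X.Vmult Φ) := by
  ext y
  apply le_antisymm
  · have h1 := Y.Vmult_mono (Vmap_mono (VmapHom f) (X.le_yo_Vmult Φ)) y
    rw [Vmap_yo, Vmult_yo] at h1
    exact h1
  · have h1 := Y.Vmult_mono (Vmap_mono (VmapHom f) (X.Vmap_yo_Vmult_le Φ)) y
    have h2 : X.coyoneda ≫ VmapHom f = f ≫ Y.coyoneda :=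
      hom_ext fun x => Vmap_yo f x
    rw [← Vmap_comp, h2, Vmap_comp, Vmult_Vmap_yo] at h1
    exact h1

theorem Vmult_assoc (X : TCat 𝒯) (Ψ : X.Vobj.Vobj.VPow) :
    X.Vmult (Vmap X.VmultHom Ψ) = X.Vmult (X.Vobj.Vmult Ψ) := by
  ext x
  apply le_antisymm
  · have h1 := X.Vmult_mono (Vmap_mono X.VmultHom (X.Vobj.le_yo_Vmult Ψ)) x
    rw [Vmap_yo, Vmult_yo] at h1
    exact h1
  · refine X.Vmult_mono (fun h => ?_) x
    have h1 : ∀ Φ, Ψ.val Φ ≤ (Vmap X.Vobj.coyoneda (Vmap X.VmultHom Ψ)).val Φ := by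
      intro Φ
      rw [← Vmap_comp]
      refine le_trans ?_ (le_postcomp _ _ (𝒯.e Φ) Φ)
      rw [ξT_tunit]
      refine le_mul_of_one_le_right' ?_
      unfold lowerStar
      rw [map_e]
      refine le_VStr_iff.2 fun h => ?_
      rw [one_mul, mu_tunit]
      exact X.le_yo_Vmult Φ h
    have h2 := X.Vobj.Vmult_mono h1 h
    rwa [Vmult_Vmap_yo] at h2

end TCat

/-- The monad `V` on the category of `𝒯`-categories, with `V X = (V^X)^op`, `V f = f_⊛ ∘ -`, the
Yoneda functors as unit and `yo^⊛ ∘ -` as multiplication. -/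
def vietorisMonad (𝒯 : TopologicalTheory V) [Subsingleton (𝒯.F PUnit.{u + 1})] :
    CategoryTheory.Monad (TCat 𝒯) where
  obj X := X.Vobj
  map f := TCat.VmapHom f
  map_id X := TCat.hom_ext fun h => X.Vmap_id h
  map_comp f g := TCat.hom_ext fun h => TCat.Vmap_comp f g h
  η :=
    { app := fun X => X.coyoneda
      naturality := fun _ _ f => TCat.hom_ext fun x => (TCat.Vmap_yo f x).symm }
  μ :=
    { app := fun X => X.VmultHom
      naturality := fun _ _ f => TCat.hom_ext fun Φ => TCat.Vmult_natural f Φ }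
  assoc X := TCat.hom_ext fun Ψ => X.Vmult_assoc Ψ
  left_unit X := TCat.hom_ext fun h => X.Vmult_yo h
  right_unit X := TCat.hom_ext fun h => X.Vmult_Vmap_yo h

/-!
Every weighted limit is an infimum: the limit of `h : A ⟶ X` weighted by `φ` is the limit of `𝟙 X`
weighted by `Vh φ`, and `x` is the latter for a weight `φ` of `X` iff `a (t, x)` is the value of the
structure of `V X` at `(T yo t, φ)`, for all `t`. So `X` is complete iff every `φ` in `V X` has an
infimum, and choosing infima is the same as giving a right adjoint of the Yoneda functor.

The monad `V` is lax idempotent: `yo_{VX} ≤ V yo_X`. Hence a retraction `α` of `yo_X` is right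
adjoint to it, since `α ≫ yo_X = yo_{VX} ≫ Vα ≤ V yo_X ≫ Vα = V (yo_X ≫ α) = 1`. Conversely, a right
adjoint `α` of `yo_X` with `X` separated is an algebra structure: `w ≫ α` and `Vα ≫ α` are right
adjoint to `yo_X ≫ yo_{VX}` and `yo_X ≫ V yo_X`, which agree by naturality of `yo`. As right
adjoints into a separated `𝒯`-category are unique, algebra structures are determined by their
carriers, and their homomorphisms are the `𝒯`-functors preserving infima.
-/

namespace TCat

variable {𝒯 : TopologicalTheory V} {X Y Z : TCat 𝒯}

/-! ### The order on `𝒯`-functors -/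

theorem hom_le_iff {f g : X ⟶ Y} : f ≤ g ↔ ∀ x, 1 ≤ Y.str (𝒯.e (f.toFun x)) (g.toFun x) := by
  refine ⟨fun h x => (Y.refl _).trans (h _ x), fun h t x => ?_⟩
  calc Y.str t (f.toFun x)
      ≤ 𝒯.ext Y.str (𝒯.e t) (𝒯.e (f.toFun x)) * Y.str (𝒯.e (f.toFun x)) (g.toFun x) :=
        (𝒯.le_ext_tunit Y.str t (f.toFun x)).trans (le_mul_of_one_le_right' (h x))
    _ ≤ Y.str (𝒯.m (𝒯.e t)) (g.toFun x) := Y.trans _ _ _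
    _ = Y.str t (g.toFun x) := by rw [m_e]

theorem lowerStar_le_lowerStar {S : Type u} {f g : S → X.carrier}
    (h : ∀ s, 1 ≤ X.str (𝒯.e (f s)) (g s)) (t : 𝒯.F S) (x : X.carrier) :
    lowerStar X g t x ≤ lowerStar X f t x := by
  have one_le : 1 ≤ 𝒯.ext X.str (𝒯.map (fun s => 𝒯.e (f s)) t) (𝒯.map g t) :=
    (𝒯.one_le_ext h t).trans (𝒯.ext_comap_le (fun s => 𝒯.e (f s)) g X.str t t)
  have mult : 𝒯.m (𝒯.map (fun s => 𝒯.e (f s)) t) = 𝒯.map f t := by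
    rw [← 𝒯.map_map (fun x => 𝒯.e x) f, m_map_e]
  calc X.str (𝒯.map g t) x
      ≤ 𝒯.ext X.str (𝒯.map (fun s => 𝒯.e (f s)) t) (𝒯.map g t) * X.str (𝒯.map g t) x :=
        le_mul_of_one_le_left' one_le
    _ ≤ X.str (𝒯.map f t) x := (X.trans _ _ _).trans_eq (by rw [mult])

instance : Preorder (X ⟶ Y) where
  le_refl _ _ _ := le_rfl
  le_trans _ _ _ hfg hgh t x := (hfg t x).trans (hgh t x)

theorem comp_le_comp_left (f : X ⟶ Y) {g g' : Y ⟶ Z} (h : g ≤ g') : f ≫ g ≤ f ≫ g' :=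
  fun t x => h t (f.toFun x)

theorem comp_le_comp_right {f f' : X ⟶ Y} (h : f ≤ f') (g : Y ⟶ Z) : f ≫ g ≤ f' ≫ g :=
  hom_le_iff.2 fun x => by
    have := (hom_le_iff.1 h x).trans (g.isFunctor _ _)
    rwa [map_e] at this

theorem IsAdjoint.comp {f : X ⟶ Y} {g : Y ⟶ X} {f' : Y ⟶ Z} {g' : Z ⟶ Y} (h : IsAdjoint f g)
    (h' : IsAdjoint f' g') : IsAdjoint (f ≫ f') (g' ≫ g) := by
  constructor
  · calc 𝟙 X ≤ f ≫ 𝟙 Y ≫ g := by simpa only [Category.id_comp] using h.1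
      _ ≤ f ≫ (f' ≫ g') ≫ g := comp_le_comp_left f (comp_le_comp_right h'.1 g)
      _ = (f ≫ f') ≫ g' ≫ g := by simp only [Category.assoc]
  · calc (g' ≫ g) ≫ f ≫ f' = g' ≫ (g ≫ f) ≫ f' := by simp only [Category.assoc]
      _ ≤ g' ≫ 𝟙 Y ≫ f' := comp_le_comp_left g' (comp_le_comp_right h.2 f')
      _ ≤ 𝟙 Z := by simpa only [Category.id_comp] using h'.2

theorem IsAdjoint.right_le {f : X ⟶ Y} {g g' : Y ⟶ X} (h : IsAdjoint f g) (h' : IsAdjoint f g') :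
    g ≤ g' :=
  calc g = g ≫ 𝟙 X := (Category.comp_id g).symm
    _ ≤ g ≫ f ≫ g' := comp_le_comp_left g h'.1
    _ = (g ≫ f) ≫ g' := (Category.assoc g f g').symm
    _ ≤ 𝟙 Y ≫ g' := comp_le_comp_right h.2 g'
    _ = g' := Category.id_comp g'

theorem IsAdjoint.right_unique (hX : X.IsSeparated) {f : X ⟶ Y} {g g' : Y ⟶ X}
    (h : IsAdjoint f g) (h' : IsAdjoint f g') : g = g' :=
  hX Y g g' (h.right_le h') (h'.right_le h)

theorem IsSeparated.of_comp_eq_id (hY : Y.IsSeparated) {f : X ⟶ Y} {g : Y ⟶ X}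
    (hfg : f ≫ g = 𝟙 X) : X.IsSeparated := fun Z p q hpq hqp => by
  have : p ≫ f = q ≫ f := hY Z _ _ (comp_le_comp_right hpq f) (comp_le_comp_right hqp f)
  simpa only [Category.assoc, hfg, Category.comp_id] using congrArg (· ≫ g) this

/-- The `𝒯`-functor `G ⟶ X` that picks the element `x`. -/
def pointHom (X : TCat 𝒯) (x : X.carrier) : G 𝒯 ⟶ X :=
  Hom.mk (fun _ => x) fun t p => iSup_le fun (h : 𝒯.e p = t) => by
    rw [← h, map_e]
    exact X.refl x

theorem IsSeparated.eq_of_str_eq (hX : X.IsSeparated) {x y : X.carrier}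
    (h : ∀ t, X.str t x = X.str t y) : x = y :=
  congrFun (congrArg Hom.toFun (hX (G 𝒯) (X.pointHom x) (X.pointHom y)
    (fun t _ => (h t).le) (fun t _ => (h t).ge))) PUnit.unit

/-- The weight `G ⇸ X` with constant value `φ`; as `T1 = 1`, all weights are of this form. -/
def VPow.weight (φ : X.VPow) : 𝒯.F PUnit.{u + 1} → X.carrier → V := fun _ => φ.val

variable [Subsingleton (𝒯.F PUnit.{u + 1})]

/-! ### Weighted limits as infima -/

theorem VPow.isDistributor_weight (φ : X.VPow) : IsDistributor (G 𝒯) X φ.weight := by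
  constructor
  · refine fun _ _ => 𝒯.kleisli_le fun s r _ => mul_le_of_le_one_left' (𝒯.ext_le fun w _ _ => ?_)
    rw [← 𝒯.ξT_one w]
    exact 𝒯.ξT_mono (fun p => (str_G p.1 p.2).le) w
  · refine fun _ x => 𝒯.kleisli_le fun s r _ => 𝒯.ext_mul_le fun w _ hw => ?_
    have := φ.le (𝒯.map Prod.snd w) x
    rwa [ξT_map, hw] at this

theorem isDistributor_iff_exists_weight {φ : 𝒯.F PUnit.{u + 1} → X.carrier → V} :
    IsDistributor (G 𝒯) X φ ↔ ∃ ψ : X.VPow, ψ.weight = φ := by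
  constructor
  · refine fun hφ => ⟨⟨φ (𝒯.e PUnit.unit), (isFunctor_iff X _).2 fun t x => ?_⟩, ?_⟩
    · have := (𝒯.le_kleisli X.str φ (𝒯.e (𝒯.e PUnit.unit)) t x).trans (hφ.2 _ x)
      rwa [ext_tunit, m_e] at this
    · exact funext fun t => congrArg φ (Subsingleton.elim _ t)
  · rintro ⟨ψ, rfl⟩
    exact ψ.isDistributor_weight

/-- `x` is an infimum of `φ ∈ V X`, that is, a limit of `𝟙 X` weighted by `φ`
(see `isLimit_weight_iff`), expressed through the structure of `V X`. -/
def IsInfimum (φ : X.VPow) (x : X.carrier) : Prop := ∀ t, X.str t x = X.VStr (𝒯.map X.yo t) φ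

theorem le_VStr_Vmap_iff (f : X ⟶ Y) {p : 𝒯.F Y.VPow} {φ : X.VPow} {v : V} :
    v ≤ Y.VStr p (Vmap f φ) ↔ ∀ x, v * φ.val x ≤ Y.mu p (f.toFun x) := by
  rw [le_VStr_iff]
  refine ⟨fun h x => (mul_le_mul' le_rfl (le_Vmap f φ x)).trans (h _), fun h y => ?_⟩
  refine (mul_postcomp_le (lowerStar Y f.toFun) h y).trans (postcomp_le fun t => ?_)
  have := (Y.muMap p).le (𝒯.map f.toFun t) y
  rwa [ξT_map] at this

theorem isLimit_weight_iff (h : Y ⟶ X) (φ : Y.VPow) (x : X.carrier) :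
    IsLimit h φ.weight x ↔ IsInfimum (Vmap h φ) x := by
  have VStr_eq (t : 𝒯.F X.carrier) : X.VStr (𝒯.map X.yo t) (Vmap h φ) =
      ⨅ y, φ.val y ⇨ₗ X.str t (h.toFun y) :=
    eq_of_forall_le_iff fun v => by
      simp only [le_VStr_Vmap_iff, mu_map_yo, le_iInf_iff, leftMulResiduation_le_iff_mul_le]
  refine Iff.trans ?_ (forall_congr' fun t => by rw [VStr_eq])
  exact ⟨fun H t => congrFun (congrFun H t) PUnit.unit, fun H => funext₂ fun t _ => H t⟩

theorem isLimit_id_weight_iff (φ : X.VPow) (x : X.carrier) :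
    IsLimit (𝟙 X) φ.weight x ↔ IsInfimum φ x := by
  rw [isLimit_weight_iff, Vmap_id]

theorem isComplete_iff_forall_exists_isInfimum :
    X.IsComplete ↔ ∀ φ : X.VPow, ∃ x, IsInfimum φ x := by
  constructor
  · intro hX φ
    simpa only [isLimit_id_weight_iff] using hX X (𝟙 X) _ φ.isDistributor_weight
  · intro hX A h φ hφ
    obtain ⟨ψ, rfl⟩ := isDistributor_iff_exists_weight.1 hφ
    simpa only [isLimit_weight_iff] using hX (Vmap h ψ)

theorem isContinuous_iff_forall_isInfimum {f : X ⟶ Y} :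
    IsContinuous f ↔
      ∀ (φ : X.VPow) (x : X.carrier), IsInfimum φ x → IsInfimum (Vmap f φ) (f.toFun x) := by
  constructor
  · intro hf φ x hx
    have := hf X (𝟙 X) _ φ.isDistributor_weight x ((isLimit_id_weight_iff φ x).2 hx)
    rwa [Category.id_comp, isLimit_weight_iff] at this
  · intro hf A h φ hφ x hx
    obtain ⟨ψ, rfl⟩ := isDistributor_iff_exists_weight.1 hφ
    rw [isLimit_weight_iff] at hx ⊢
    rw [Vmap_comp]
    exact hf _ x hx

theorem IsSeparated.isInfimum_unique (hX : X.IsSeparated) {φ : X.VPow} {x y : X.carrier}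
    (hx : IsInfimum φ x) (hy : IsInfimum φ y) : x = y :=
  hX.eq_of_str_eq fun t => (hx t).trans (hy t).symm

/-! ### Infima and right adjoints of the Yoneda functor -/

theorem one_le_VStr_tunit_iff {φ ψ : X.VPow} :
    1 ≤ X.VStr (𝒯.e φ) ψ ↔ ∀ x, ψ.val x ≤ φ.val x := by
  simp only [le_VStr_iff, one_mul, mu_tunit]

theorem hom_Vobj_le_iff {f g : Y ⟶ X.Vobj} :
    f ≤ g ↔ ∀ y x, (g.toFun y).val x ≤ (f.toFun y).val x :=
  hom_le_iff.trans (forall_congr' fun _ => one_le_VStr_tunit_iff)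

theorem VStr_map_yo_yo (t : 𝒯.F X.carrier) (x : X.carrier) :
    X.VStr (𝒯.map X.yo t) (X.yo x) = X.str t x := by
  rw [VStr_yo, mu_map_yo]

theorem isInfimum_yo (x : X.carrier) : IsInfimum (X.yo x) x := fun t => (VStr_map_yo_yo t x).symm

theorem IsInfimum.one_le_VStr {φ : X.VPow} {x : X.carrier} (h : IsInfimum φ x) :
    1 ≤ X.VStr (𝒯.e (X.yo x)) φ := by
  simpa only [h (𝒯.e x), map_e] using X.refl x

theorem isAdjoint_coyoneda_iff {g : X.Vobj ⟶ X} :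
    IsAdjoint X.coyoneda g ↔ ∀ φ, IsInfimum φ (g.toFun φ) := by
  constructor
  · rintro ⟨unit, counit⟩ φ t
    apply le_antisymm
    · rw [← VStr_map_yo_yo]
      exact counit _ φ
    · calc X.VStr (𝒯.map X.yo t) φ ≤ lowerStar X (X.coyoneda ≫ g).toFun t (g.toFun φ) :=
            (g.isFunctor _ φ).trans_eq (by rw [map_map]; rfl)
        _ ≤ lowerStar X (𝟙 X : X ⟶ X).toFun t (g.toFun φ) :=
            lowerStar_le_lowerStar (hom_le_iff.1 unit) t _
        _ = X.str t (g.toFun φ) := congrArg (X.str · _) (𝒯.map_id t)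
  · intro hg
    exact ⟨fun t x => ((isInfimum_yo x t).trans (hg (X.yo x) t).symm).le,
      hom_le_iff.2 fun φ => (hg φ).one_le_VStr⟩

/-- The `𝒯`-functor `V X ⟶ X` given by a choice of infima. -/
def infHom (inf : X.VPow → X.carrier) (h : ∀ φ, IsInfimum φ (inf φ)) : X.Vobj ⟶ X :=
  Hom.mk inf fun p φ => by
    have := lowerStar_le_lowerStar (X := X.Vobj) (g := fun φ => φ) (fun φ => (h φ).one_le_VStr) p φ
    rw [h φ, map_map]
    simpa only [lowerStar, map_id] using this

theorem isComplete_iff_exists_isAdjoint :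
    X.IsComplete ↔ ∃ inf : X.Vobj ⟶ X, IsAdjoint X.coyoneda inf := by
  rw [isComplete_iff_forall_exists_isInfimum]
  constructor
  · intro hX
    choose inf hinf using hX
    exact ⟨infHom inf hinf, isAdjoint_coyoneda_iff.2 hinf⟩
  · rintro ⟨inf, h⟩ φ
    exact ⟨inf.toFun φ, isAdjoint_coyoneda_iff.1 h φ⟩

theorem isContinuous_iff_comp_eq (hX : X.IsSeparated) (hY : Y.IsSeparated) {α : X.Vobj ⟶ X}
    {β : Y.Vobj ⟶ Y} (hα : IsAdjoint X.coyoneda α) (hβ : IsAdjoint Y.coyoneda β) {f : X ⟶ Y} :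
    IsContinuous f ↔ VmapHom f ≫ β = α ≫ f := by
  rw [isAdjoint_coyoneda_iff] at hα hβ
  rw [isContinuous_iff_forall_isInfimum]
  constructor
  · exact fun hf => hom_ext fun φ => hY.isInfimum_unique (hβ (Vmap f φ)) (hf φ _ (hα φ))
  · intro hf φ x hx
    obtain rfl : x = α.toFun φ := hX.isInfimum_unique hx (hα φ)
    have map_inf : β.toFun (Vmap f φ) = f.toFun (α.toFun φ) :=
      congrFun (congrArg Hom.toFun hf) φ
    exact map_inf ▸ hβ (Vmap f φ)

/-! ### Lax idempotency -/

theorem VmapHom_id (X : TCat 𝒯) : VmapHom (𝟙 X) = 𝟙 X.Vobj := hom_ext X.Vmap_id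

theorem VmapHom_comp (f : X ⟶ Y) (g : Y ⟶ Z) : VmapHom (f ≫ g) = VmapHom f ≫ VmapHom g :=
  hom_ext (Vmap_comp f g)

theorem coyoneda_comp_VmapHom (f : X ⟶ Y) : X.coyoneda ≫ VmapHom f = f ≫ Y.coyoneda :=
  hom_ext (Vmap_yo f)

theorem VmapHom_mono {f g : X ⟶ Y} (h : f ≤ g) : VmapHom f ≤ VmapHom g :=
  hom_Vobj_le_iff.2 fun φ y => postcomp_le fun t =>
    (mul_le_mul' le_rfl (lowerStar_le_lowerStar (hom_le_iff.1 h) t y)).trans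
      (le_postcomp _ φ.val t y)

theorem IsAdjoint.VmapHom {f : X ⟶ Y} {g : Y ⟶ X} (h : IsAdjoint f g) :
    IsAdjoint (VmapHom f) (VmapHom g) := by
  constructor
  · rw [← VmapHom_id, ← VmapHom_comp]
    exact VmapHom_mono h.1
  · rw [← VmapHom_id, ← VmapHom_comp]
    exact VmapHom_mono h.2

theorem coyoneda_Vobj_le (X : TCat 𝒯) : X.Vobj.coyoneda ≤ VmapHom X.coyoneda :=
  hom_Vobj_le_iff.2 fun φ ψ => by
    have := X.le_yo_Vmult (Vmap X.coyoneda φ) ψ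
    rwa [Vmult_Vmap_yo] at this

theorem isAdjoint_coyoneda_of_comp_eq_id {α : X.Vobj ⟶ X} (hα : X.coyoneda ≫ α = 𝟙 X) :
    IsAdjoint X.coyoneda α :=
  ⟨hα.ge,
    calc α ≫ X.coyoneda = X.Vobj.coyoneda ≫ VmapHom α := (coyoneda_comp_VmapHom α).symm
      _ ≤ VmapHom X.coyoneda ≫ VmapHom α := comp_le_comp_right X.coyoneda_Vobj_le _
      _ = 𝟙 X.Vobj := by rw [← VmapHom_comp, hα, VmapHom_id]⟩

theorem isAdjoint_coyoneda_VmultHom (X : TCat 𝒯) : IsAdjoint X.Vobj.coyoneda X.VmultHom :=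
  isAdjoint_coyoneda_of_comp_eq_id (hom_ext X.Vmult_yo)

theorem isSeparated_Vobj (X : TCat 𝒯) : X.Vobj.IsSeparated := fun _ _ _ hfg hgf =>
  hom_ext fun y => VPow.ext <| funext fun x =>
    le_antisymm (hom_Vobj_le_iff.1 hgf y x) (hom_Vobj_le_iff.1 hfg y x)

theorem IsSeparated.coyoneda_comp_eq_id (hX : X.IsSeparated) {α : X.Vobj ⟶ X}
    (hα : IsAdjoint X.coyoneda α) : X.coyoneda ≫ α = 𝟙 X :=
  hom_ext fun x => hX.isInfimum_unique (isAdjoint_coyoneda_iff.1 hα (X.yo x)) (isInfimum_yo x)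

theorem IsSeparated.VmultHom_comp (hX : X.IsSeparated) {α : X.Vobj ⟶ X}
    (hα : IsAdjoint X.coyoneda α) : X.VmultHom ≫ α = VmapHom α ≫ α := by
  have hVα : IsAdjoint (X.coyoneda ≫ X.Vobj.coyoneda) (VmapHom α ≫ α) := by
    rw [← coyoneda_comp_VmapHom]
    exact hα.comp hα.VmapHom
  exact (hα.comp X.isAdjoint_coyoneda_VmultHom).right_unique hX hVα

end TCat

namespace vietorisMonad

variable {𝒯 : TopologicalTheory V} [Subsingleton (𝒯.F PUnit.{u + 1})]

/-! ### Algebras -/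

theorem isAdjoint_algebra (A : (vietorisMonad 𝒯).Algebra) : TCat.IsAdjoint A.A.coyoneda A.a :=
  TCat.isAdjoint_coyoneda_of_comp_eq_id A.unit

theorem isComplete_algebra (A : (vietorisMonad 𝒯).Algebra) : A.A.IsComplete :=
  TCat.isComplete_iff_exists_isAdjoint.2 ⟨A.a, isAdjoint_algebra A⟩

theorem isSeparated_algebra (A : (vietorisMonad 𝒯).Algebra) : A.A.IsSeparated :=
  A.A.isSeparated_Vobj.of_comp_eq_id A.unit

theorem isContinuous_iff_algebraHom {A B : (vietorisMonad 𝒯).Algebra} {f : A.A ⟶ B.A} :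
    TCat.IsContinuous f ↔ (vietorisMonad 𝒯).map f ≫ B.a = A.a ≫ f :=
  TCat.isContinuous_iff_comp_eq (isSeparated_algebra A) (isSeparated_algebra B)
    (isAdjoint_algebra A) (isAdjoint_algebra B)

/-- The algebra structure on a separated `𝒯`-category given by a right adjoint of the Yoneda
functor. -/
def algebraOfIsAdjoint {X : TCat 𝒯} (hX : X.IsSeparated) {α : X.Vobj ⟶ X}
    (hα : TCat.IsAdjoint X.coyoneda α) : (vietorisMonad 𝒯).Algebra where
  A := X
  a := α
  unit := hX.coyoneda_comp_eq_id hα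
  assoc := hX.VmultHom_comp hα

variable (𝒯)

/-- The functor `(X, α) ↦ X` from algebras to complete separated `𝒯`-categories. -/
def toCompleteSep : (vietorisMonad 𝒯).Algebra ⥤ CompleteSepTCat 𝒯 where
  obj A := ⟨A.A, isComplete_algebra A, isSeparated_algebra A⟩
  map f := CompleteSepTCat.Hom.mk f.f (isContinuous_iff_algebraHom.2 f.h)

theorem toCompleteSep_obj_injective : Function.Injective (toCompleteSep 𝒯).obj := by
  intro A B h
  have hA := isAdjoint_algebra A
  have hB := isAdjoint_algebra B
  have hsep := isSeparated_algebra A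
  obtain ⟨X, α, _, _⟩ := A
  obtain ⟨Y, β, _, _⟩ := B
  obtain rfl : X = Y := congrArg CompleteSepTCat.toTCat h
  obtain rfl : α = β := hA.right_unique hsep hB
  rfl

theorem toCompleteSep_obj_surjective : Function.Surjective (toCompleteSep 𝒯).obj := by
  rintro ⟨X, hcomplete, hsep⟩
  obtain ⟨inf, hinf⟩ := TCat.isComplete_iff_exists_isAdjoint.1 hcomplete
  exact ⟨algebraOfIsAdjoint hsep hinf, rfl⟩

instance : (toCompleteSep 𝒯).Full where
  map_surjective g := ⟨⟨g.hom, isContinuous_iff_algebraHom.1 g.continuous⟩, rfl⟩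

instance : (toCompleteSep 𝒯).Faithful where
  map_injective h := Monad.Algebra.Hom.ext (congrArg CompleteSepTCat.Hom.hom h)

end vietorisMonad

theorem mainTheorem4 {V : Type u} [CommMonoid V] [CompleteLattice V] [IsQuantale V]
    (hV : (⊥ : V) ≠ 1) (𝒯 : TopologicalTheory V) [Subsingleton (𝒯.T.obj PUnit.{u + 1})] :
    (∀ X : TCat 𝒯, X.IsComplete ↔ ∃ inf : X.Vobj ⟶ X, TCat.IsAdjoint X.coyoneda inf) ∧
    ∃ Φ : (vietorisMonad 𝒯).Algebra ⥤ CompleteSepTCat 𝒯,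
      Φ ⋙ CompleteSepTCat.incl 𝒯 = (vietorisMonad 𝒯).forget ∧
      Function.Bijective Φ.obj ∧ Φ.Full ∧ Φ.Faithful :=
  ⟨fun _ => TCat.isComplete_iff_exists_isAdjoint, vietorisMonad.toCompleteSep 𝒯, rfl,
    ⟨vietorisMonad.toCompleteSep_obj_injective 𝒯, vietorisMonad.toCompleteSep_obj_surjective 𝒯⟩,
    inferInstance, inferInstance⟩
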